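/- For irrational $\alpha\in(0,1)$ and $x\in X=\mathbb R/\mathbb Z$, let $f=\chi_{[0,1/2]}-\chi_{X\setminus[0,1/2]}$, let $T_\alpha(x,n)=(x+\alpha,\,n+f(x))$ be the cylinder flow on $X\times\mathbb Z$, and let \[V_{\alpha,x}=\{n\in\mathbb Z^+ : \pi_2(T_\alpha^n(x,0))=0\}=\Big\{n\ge 1: \sum_{i=0}^{n-1} f(x+i\alpha)=0\Big\}\] be the set of balanced times, where $\pi_2(y,m)=m$. Theorem. There are uncountably many irrational $\alpha\in(0,1)$ such that for every $x\in X$, \[\sum_{n\in V_{\alpha,x}}\frac1n<\infty .\] They can be taken of the form $\alpha=[2a_1,b_1,2a_2,b_2,\ldots]$ (continued fraction expansion) with the $b_i$ bounded and the $a_i$ growing as fast as desired. Precisely: for every integer $M\ge1$ and every sequence of positive reals $(c_n)_{n\ge1}$ with $\sum_n c_n<\infty$, there are uncountably many irrational $\alpha=[2a_1,b_1,2a_2,b_2,\ldots]\in(0,1)$, with positive integers $a_i,b_i$ such that $b_i\le M$ for all $i$ and, writing $A_n=a_1+\cdots+a_n$, \[\frac{\log(2MA_n)}{A_n}<c_n\quad\text{for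 all } n\ge1,\] for which $\sum_{n\in V_{\alpha,x}}1/n<\infty$ for every $x\in X$. -/

import Mathlib

open Set

namespace BalancedTimes

noncomputable section

/-- The closed half circle `I = [0, 1/2]` in `ℝ / ℤ`. -/
def halfCircle : Set UnitAddCircle :=
  (fun t : ℝ => (t : UnitAddCircle)) '' Icc (0 : ℝ) (1 / 2)

open Classical in
/-- `f = χ_I - χ_{X \ I}`: it is `1` on `I = [0, 1/2]` and `-1` off `I`. -/
def stepFun (x : UnitAddCircle) : ℤ :=
  if x ∈ halfCircle then 1 else -1

/-- The cylinder flow `T_α (x, n) = (x + α, n + f x)` on `(ℝ / ℤ) × ℤ`. -/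
def cylinderFlow (α : ℝ) (z : UnitAddCircle × ℤ) : UnitAddCircle × ℤ :=
  (z.1 + (α : UnitAddCircle), z.2 + stepFun z.1)

/-- The balanced times `V_{α,x}`: the integers `n ≥ 1` at which the orbit of `(x, 0)` under the
cylinder flow is at level zero. -/
def balancedTimes (α : ℝ) (x : UnitAddCircle) : Set ℕ :=
  {n : ℕ | 0 < n ∧ ((cylinderFlow α)^[n] (x, 0)).2 = 0}

/-- For `α ∈ (0, 1)`: the continued fraction expansion of `α` is
`[2 a₁, b₁, 2 a₂, b₂, …]`, where `a₁, a₂, …` are `a 0, a 1, …` and `b₁, b₂, …` are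
`b 0, b 1, …`. -/
def HasAlternatingExpansion (α : ℝ) (a b : ℕ → ℕ) : Prop :=
  ∀ n : ℕ, (GenContFract.of α).partDens.get? (2 * n) = some (2 * (a n : ℝ)) ∧
    (GenContFract.of α).partDens.get? (2 * n + 1) = some (b n : ℝ)

/-- The sums `A_{n+1} = a₁ + ⋯ + a_{n+1}`, that is `a 0 + ⋯ + a n`. -/
def heightSum (a : ℕ → ℕ) (n : ℕ) : ℕ :=
  ∑ i ∈ Finset.range (n + 1), a i

end

end BalancedTimes

/-! Take every `b_i = 1`. The denominators `Q_k = q_{2k}` are then odd, and rotating `Q_k` times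
moves a point forward by a small `E ≥ 0` with `(2 a_k + 2) E ≤ 2` (`exists_approx`, with `a` indexed
from `0`). A block of `Q_k` steps changes the height by an odd, hence nonzero, amount. As the
block's start drifts by multiples of `E`, this amount can change only when one of its `Q_k` points
crosses an endpoint of the half circle, which happens `O(Q_k)` times in `2 a_k + 2` blocks. Between
changes the heights at block starts form a nonconstant arithmetic progression, so only `O(Q_k ^ 2)`
blocks come near a given level (`card_blocks_le`), and before time `Q_{k+1}` a level is hit `O(Q_k ^
3)` times (`card_level_le`).

Using this count inside each block of length `Q_{k+1}`, and the block count at that scale, the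
balanced times in `[Q_{k+1}, Q_{k+2})` contribute `O(Q_k ^ 3 log Q_{k+1} / Q_{k+1})`
(`sum_inv_balanced_le`). As `Q_{k+1} ≥ a_k` and `a_k` is chosen after `Q_k`, this is at most `2 ^
(-k)`, whatever the starting point. Each `a_k` keeps enough freedom to diagonalize against any
countable list. -/

namespace BalancedTimes

/-! ### Heights along the flow -/

/-- A monotone integer-valued function whose parity determines `stepFun`. -/
noncomputable def halfTurns (t : ℝ) : ℤ := ⌊t⌋ + ⌈t - 1 / 2⌉

theorem halfTurns_mono : Monotone halfTurns := fun _ _ h =>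
  add_le_add (Int.floor_mono h) (Int.ceil_mono (sub_le_sub_right h _))

theorem halfTurns_add_le (t s : ℝ) : (halfTurns (t + s) : ℝ) ≤ halfTurns t + 2 * s + 2 := by
  have h1 := Int.floor_le (t + s)
  have h2 := Int.ceil_lt_add_one (t + s - 1 / 2)
  have h3 := Int.lt_floor_add_one t
  have h4 := Int.le_ceil (t - 1 / 2)
  simp only [halfTurns, Int.cast_add]
  linarith

/-- The floor jumps on reaching an integer, the ceiling only just after a half-integer; this matches
an arc closed at both ends. -/
theorem stepFun_coe (t : ℝ) : stepFun (t : UnitAddCircle) = if Even (halfTurns t) then 1 else -1 := by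
  have key : (t : UnitAddCircle) ∈ halfCircle ↔ Even (halfTurns t) := by
    constructor
    · rintro ⟨s, ⟨hs0, hs1⟩, hst⟩
      obtain ⟨m, hm⟩ := (AddCircle.coe_eq_zero_iff (p := (1 : ℝ)) (x := t - s)).1
        (by rw [AddCircle.coe_sub, sub_eq_zero]; exact hst.symm)
      have ht : t = s + m := by
        rw [zsmul_eq_mul, mul_one] at hm
        linarith
      have h1 : ⌊s⌋ = 0 := Int.floor_eq_iff.2 ⟨by simpa using hs0, by norm_num; linarith⟩
      have h2 : ⌈s - 1 / 2⌉ = 0 := Int.ceil_eq_iff.2 ⟨by norm_num; linarith, by norm_num; linarith⟩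
      rw [halfTurns, ht, Int.floor_add_intCast, add_sub_right_comm, Int.ceil_add_intCast, h1, h2]
      exact ⟨m, by ring⟩
    · intro h
      refine ⟨Int.fract t, ⟨Int.fract_nonneg t, ?_⟩, ?_⟩
      · by_contra! hlt
        have h1 : ⌈t - 1 / 2⌉ = ⌊t⌋ + 1 := by
          rw [Int.ceil_eq_iff]
          have := Int.fract_lt_one t
          have := Int.floor_add_fract t
          push_cast
          constructor <;> linarith
        rw [halfTurns, h1] at h
        grind
      · rw [← sub_eq_zero, ← AddCircle.coe_sub, AddCircle.coe_eq_zero_iff]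
        exact ⟨-⌊t⌋, by rw [Int.fract, zsmul_eq_mul]; push_cast; ring⟩
  simp only [stepFun, key]

theorem odd_stepFun (y : UnitAddCircle) : Odd (stepFun y) := by
  unfold stepFun
  split_ifs <;> decide

theorem abs_stepFun (y : UnitAddCircle) : |stepFun y| = 1 := by
  unfold stepFun
  split_ifs <;> rfl

/-- The second coordinate of the `n`-th iterate of the cylinder flow, started at height `0`. -/
noncomputable def height (α : ℝ) (n : ℕ) (y : UnitAddCircle) : ℤ :=
  ∑ i ∈ Finset.range n, stepFun (y + i • (α : UnitAddCircle))

theorem cylinderFlow_iterate (α : ℝ) (n : ℕ) (y : UnitAddCircle) :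
    (cylinderFlow α)^[n] (y, 0) = (y + n • (α : UnitAddCircle), height α n y) := by
  induction n with
  | zero => simp [height]
  | succ n ih =>
    rw [Function.iterate_succ_apply', ih]
    simp only [cylinderFlow, height, Finset.sum_range_succ, succ_nsmul, add_assoc]

theorem mem_balancedTimes {α : ℝ} {x : UnitAddCircle} {n : ℕ} :
    n ∈ balancedTimes α x ↔ 0 < n ∧ height α n x = 0 := by
  simp only [balancedTimes, mem_ofPred_eq, cylinderFlow_iterate]

theorem height_add (α : ℝ) (m n : ℕ) (y : UnitAddCircle) :
    height α (m + n) y = height α m y + height α n (y + m • (α : UnitAddCircle)) := by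
  simp only [height, Finset.sum_range_add, add_nsmul, add_assoc]

theorem abs_height_le (α : ℝ) (n : ℕ) (y : UnitAddCircle) : |height α n y| ≤ n := by
  refine (Finset.abs_sum_le_sum_abs _ _).trans ?_
  simp [abs_stepFun]

theorem odd_height {n : ℕ} (hn : Odd n) (α : ℝ) (y : UnitAddCircle) : Odd (height α n y) := by
  have h : ∀ n : ℕ, Even (height α n y + n) := by
    intro n
    induction n with
    | zero => simp [height]
    | succ n ih =>
      have := odd_stepFun (y + n • (α : UnitAddCircle))
      rw [height, Finset.sum_range_succ, ← height]
      push_cast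
      grind
  have := h n
  grind

/-! ### Visits to a level, counted by blocks of odd length -/

section Blocks

variable {α E : ℝ} {Q L : ℕ}

theorem height_block_ne_zero (hQ : Odd Q) (y : UnitAddCircle) : height α Q y ≠ 0 := by
  intro h
  have := odd_height hQ α y
  rw [h] at this
  exact absurd this (by decide)

/-- A block is determined by the pair of `Φ`, the total number of half turns of its points, and its
starting height: blocks sharing `Φ` have distinct starting heights. -/
theorem card_blocks_le (hQ : Odd Q) (hE : 0 ≤ E)
    (hα : Q • (α : UnitAddCircle) = (E : UnitAddCircle)) (hL : L * E ≤ 2)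
    (y : UnitAddCircle) (h : ℤ) :
    ((Finset.range L).filter fun j => |height α (j * Q) y - h| ≤ Q).card ≤ 21 * Q ^ 2 := by
  obtain ⟨t, rfl⟩ := QuotientAddGroup.mk_surjective y
  have hQ1 : 1 ≤ Q := hQ.pos
  set u : ℕ → ℕ → ℤ := fun j i => halfTurns (t + i * α + j * E) with hu
  set Φ : ℕ → ℤ := fun j => ∑ i ∈ Finset.range Q, u j i with hΦ
  have u_mono : ∀ i, Monotone fun j => u j i := by
    intro i j j' hj
    apply halfTurns_mono
    gcongr
  have Φ_mono : Monotone Φ := fun j j' hj => Finset.sum_le_sum fun i _ => u_mono i hj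
  have hstart : ∀ j : ℕ, ((t : UnitAddCircle) + (j * Q) • (α : UnitAddCircle)) =
      ((t + j * E : ℝ) : UnitAddCircle) := by
    intro j
    rw [mul_nsmul', hα, ← AddCircle.coe_nsmul, ← AddCircle.coe_add, nsmul_eq_mul]
  have hblock : ∀ j : ℕ, height α Q ((t + j * E : ℝ) : UnitAddCircle) =
      ∑ i ∈ Finset.range Q, if Even (u j i) then 1 else -1 := by
    intro j
    refine Finset.sum_congr rfl fun i _ => ?_
    rw [← AddCircle.coe_nsmul, ← AddCircle.coe_add, nsmul_eq_mul, stepFun_coe,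
      add_right_comm]
  have hsucc : ∀ j : ℕ, height α ((j + 1) * Q) (t : UnitAddCircle) =
      height α (j * Q) (t : UnitAddCircle) + height α Q ((t + j * E : ℝ) : UnitAddCircle) := by
    intro j
    rw [add_mul, one_mul, height_add, hstart]
  have hconst : ∀ j j' : ℕ, j ≤ j' → Φ j = Φ j' →
      height α Q ((t + j * E : ℝ) : UnitAddCircle) =
        height α Q ((t + j' * E : ℝ) : UnitAddCircle) := by
    intro j j' hj heq
    -- Each summand of `Φ` is monotone in `j`, so equal sums force equal summands.
    have := (Finset.sum_eq_sum_iff_of_le fun i _ => u_mono i hj).1 heq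
    rw [hblock, hblock]
    exact Finset.sum_congr rfl fun i hi => by rw [show u j i = u j' i from this i hi]
  have hprog : ∀ j k : ℕ, Φ j = Φ (j + k) →
      height α ((j + k) * Q) (t : UnitAddCircle) =
        height α (j * Q) (t : UnitAddCircle) +
          k * height α Q ((t + j * E : ℝ) : UnitAddCircle) := by
    intro j k
    induction k with
    | zero => simp
    | succ k ih =>
      intro heq
      have h1 : Φ j = Φ (j + k) :=
        le_antisymm (Φ_mono (by omega)) (heq ▸ Φ_mono (by omega))
      rw [← add_assoc, hsucc, ih h1, ← hconst j (j + k) (by omega) h1]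
      push_cast
      ring
  have hlt : ∀ j j' : ℕ, j < j' → Φ j = Φ j' →
      height α (j * Q) (t : UnitAddCircle) ≠ height α (j' * Q) (t : UnitAddCircle) := by
    intro j j' hj heq
    obtain ⟨k, rfl⟩ := Nat.exists_eq_add_of_lt hj
    rw [add_assoc] at heq ⊢
    rw [hprog j (k + 1) heq]
    have h0 := height_block_ne_zero (α := α) hQ ((t + j * E : ℝ) : UnitAddCircle)
    have h1 : ((k + 1 : ℕ) : ℤ) * height α Q ((t + j * E : ℝ) : UnitAddCircle) ≠ 0 :=
      mul_ne_zero (by omega) h0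
    omega
  -- The drift is at most `2`, so `halfTurns_add_le` gives `2 * 2 + 2 = 6` per point.
  have hΦle : ∀ j ≤ L, Φ j ≤ Φ 0 + 6 * Q := by
    intro j hj
    have : ∀ i ∈ Finset.range Q, u j i ≤ u 0 i + 6 := by
      intro i _
      have h1 := halfTurns_add_le (t + i * α) (j * E)
      have h2 : (j : ℝ) * E ≤ 2 := le_trans (by gcongr) hL
      have h3 : ((u j i : ℤ) : ℝ) ≤ ((u 0 i + 6 : ℤ) : ℝ) := by
        simp only [hu, Nat.cast_zero, zero_mul, add_zero]
        push_cast
        linarith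
      exact_mod_cast h3
    calc Φ j ≤ ∑ i ∈ Finset.range Q, (u 0 i + 6) := Finset.sum_le_sum this
      _ = Φ 0 + 6 * Q := by simp [hΦ, Finset.sum_add_distrib, mul_comm]
  calc _ ≤ (Finset.Icc (Φ 0) (Φ 0 + 6 * Q) ×ˢ Finset.Icc (h - Q) (h + Q)).card := by
        refine Finset.card_le_card_of_injOn
          (fun j => (Φ j, height α (j * Q) (t : UnitAddCircle))) ?_ ?_
        · intro j hj
          simp only [Finset.coe_filter, Finset.mem_range, mem_ofPred_eq] at hj
          have := abs_le.1 hj.2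
          simp only [Finset.coe_product, mem_prod, Finset.coe_Icc, mem_Icc]
          exact ⟨⟨Φ_mono (Nat.zero_le j), hΦle j hj.1.le⟩, by omega, by omega⟩
        · intro j _ j' _ heq
          simp only [Prod.mk.injEq] at heq
          rcases lt_trichotomy j j' with hj | hj | hj
          · exact absurd heq.2 (hlt _ _ hj heq.1)
          · exact hj
          · exact absurd heq.2.symm (hlt _ _ hj heq.1.symm)
    _ = (6 * Q + 1) * (2 * Q + 1) := by
        rw [Finset.card_product, Int.card_Icc, Int.card_Icc]
        congr 1 <;> omega
    _ ≤ 21 * Q ^ 2 := by nlinarith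

theorem abs_height_block_sub_le (y : UnitAddCircle) (n : ℕ) (hQ : 0 < Q) :
    |height α (n / Q * Q) y - height α n y| ≤ Q := by
  have h : n = n / Q * Q + n % Q := by rw [mul_comm, Nat.div_add_mod]
  have h1 := height_add α (n / Q * Q) (n % Q) y
  rw [← h] at h1
  have h2 := abs_height_le α (n % Q) (y + (n / Q * Q) • (α : UnitAddCircle))
  have h3 := Nat.mod_lt n hQ
  rw [h1, abs_sub_comm, add_sub_cancel_left]
  omega

theorem card_level_le (hQ : Odd Q) (hE : 0 ≤ E)
    (hα : Q • (α : UnitAddCircle) = (E : UnitAddCircle)) (hL : L * E ≤ 2)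
    (y : UnitAddCircle) (h : ℤ) :
    ((Finset.range (L * Q)).filter fun n => height α n y = h).card ≤ 21 * Q ^ 3 := by
  have hQ0 : 0 < Q := hQ.pos
  calc _ ≤ (((Finset.range L).filter fun j => |height α (j * Q) y - h| ≤ Q) ×ˢ
          Finset.range Q).card := by
        refine Finset.card_le_card_of_injOn (fun n => (n / Q, n % Q)) ?_ ?_
        · intro n hn
          simp only [Finset.coe_filter, Finset.mem_range, mem_ofPred_eq] at hn
          simp only [Finset.coe_product, mem_prod, Finset.coe_filter, Finset.mem_range,
            mem_ofPred_eq, Finset.coe_range, mem_Iio]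
          refine ⟨⟨Nat.div_lt_of_lt_mul (by linarith [mul_comm L Q]), ?_⟩, Nat.mod_lt _ hQ0⟩
          rw [← hn.2]
          exact abs_height_block_sub_le y n hQ0
        · intro n _ m _ heq
          simp only [Prod.mk.injEq] at heq
          rw [← Nat.div_add_mod n Q, ← Nat.div_add_mod m Q, heq.1, heq.2]
    _ ≤ 21 * Q ^ 2 * Q := by
        rw [Finset.card_product, Finset.card_range]
        exact Nat.mul_le_mul_right _ (card_blocks_le hQ hE hα hL y h)
    _ = 21 * Q ^ 3 := by ring

/-- Elements up to `N` are bounded by the harmonic sum; the at most `N` others contribute at most `1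
/ N` each. -/
theorem sum_inv_le_two_add_log {J : Finset ℕ} (hJ : ∀ j ∈ J, 0 < j) {N : ℕ} (hN : 0 < N)
    (hcard : J.card ≤ N) : ∑ j ∈ J, (1 / j : ℝ) ≤ 2 + Real.log N := by
  have hN' : (0 : ℝ) < N := by exact_mod_cast hN
  rw [← Finset.sum_filter_add_sum_filter_not J (fun j => j ≤ N)]
  have h1 : ∑ j ∈ J with j ≤ N, (1 / j : ℝ) ≤ 1 + Real.log N := by
    have := harmonic_le_one_add_log N
    rw [harmonic_eq_sum_Icc] at this
    push_cast at this
    refine le_trans ?_ this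
    simp only [one_div]
    refine Finset.sum_le_sum_of_subset_of_nonneg ?_ fun _ _ _ => by positivity
    intro j hj
    rw [Finset.mem_filter] at hj
    exact Finset.mem_Icc.2 ⟨hJ j hj.1, hj.2⟩
  have h2 : ∑ j ∈ J with ¬ j ≤ N, (1 / j : ℝ) ≤ 1 := by
    calc ∑ j ∈ J with ¬ j ≤ N, (1 / j : ℝ) ≤ ∑ j ∈ J with ¬ j ≤ N, (1 / N : ℝ) := by
          refine Finset.sum_le_sum fun j hj => ?_
          rw [Finset.mem_filter, not_le] at hj
          gcongr
          exact_mod_cast hj.2.le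
      _ ≤ ∑ j ∈ J, (1 / N : ℝ) :=
          Finset.sum_le_sum_of_subset_of_nonneg (Finset.filter_subset _ _)
            fun _ _ _ => by positivity
      _ = J.card * (1 / N) := by rw [Finset.sum_const, nsmul_eq_mul]
      _ ≤ N * (1 / N) := by gcongr
      _ = 1 := by field_simp
  linarith

/-- If every level is visited at most `B` times in any block of length `Q`, then the balanced
times in the blocks `1, …, L - 1` have a small sum of reciprocals. -/
theorem sum_inv_balanced_le (hQ : Odd Q) (hE : 0 ≤ E)
    (hα : Q • (α : UnitAddCircle) = (E : UnitAddCircle)) (hL : L * E ≤ 2) {B : ℕ}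
    (hB : ∀ (y : UnitAddCircle) (h : ℤ),
      ((Finset.range Q).filter fun n => height α n y = h).card ≤ B)
    (x : UnitAddCircle) :
    ∑ n ∈ (Finset.Ico Q (L * Q)).filter (fun n => height α n x = 0), (1 / n : ℝ) ≤
      B / Q * (2 + Real.log (21 * Q ^ 2)) := by
  have hQ0 : 0 < Q := hQ.pos
  have hQ' : (0 : ℝ) < Q := by exact_mod_cast hQ0
  set J := ((Finset.range L).filter fun j => |height α (j * Q) x - 0| ≤ Q).filter (0 < ·) with hJ
  have hmaps : ∀ n ∈ (Finset.Ico Q (L * Q)).filter (fun n => height α n x = 0), n / Q ∈ J := by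
    intro n hn
    simp only [Finset.mem_filter, Finset.mem_Ico] at hn
    simp only [hJ, Finset.mem_filter, Finset.mem_range]
    refine ⟨⟨Nat.div_lt_of_lt_mul (by linarith [mul_comm L Q]), ?_⟩, Nat.div_pos hn.1.1 hQ0⟩
    rw [← hn.2]
    exact abs_height_block_sub_le x n hQ0
  rw [← Finset.sum_fiberwise_of_maps_to hmaps]
  have hfib : ∀ j ∈ J, ∑ n ∈ ((Finset.Ico Q (L * Q)).filter
      (fun n => height α n x = 0)).filter (fun n => n / Q = j), (1 / n : ℝ) ≤ B / Q * (1 / j) := by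
    intro j hj
    have hj0 : 0 < j := (Finset.mem_filter.1 hj).2
    have hj' : (0 : ℝ) < j := by exact_mod_cast hj0
    have hcard : (((Finset.Ico Q (L * Q)).filter
        (fun n => height α n x = 0)).filter (fun n => n / Q = j)).card ≤ B := by
      refine le_trans ?_ (hB (x + (j * Q) • (α : UnitAddCircle)) (-height α (j * Q) x))
      refine Finset.card_le_card_of_injOn (fun n => n % Q) ?_ ?_
      · intro n hn
        simp only [Finset.coe_filter, Finset.mem_filter, mem_ofPred_eq] at hn
        simp only [Finset.coe_filter, Finset.mem_range, mem_ofPred_eq]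
        refine ⟨Nat.mod_lt _ hQ0, ?_⟩
        have h1 := height_add α (j * Q) (n % Q) x
        rw [← hn.2, mul_comm, Nat.div_add_mod, hn.1.2] at h1
        rw [← hn.2, mul_comm]
        omega
      · intro n hn m hm heq
        simp only [Finset.coe_filter, Finset.mem_filter, mem_ofPred_eq] at hn hm
        simp only at heq
        rw [← Nat.div_add_mod n Q, ← Nat.div_add_mod m Q, heq, hn.2, hm.2]
    calc _ ≤ ∑ n ∈ ((Finset.Ico Q (L * Q)).filter
          (fun n => height α n x = 0)).filter (fun n => n / Q = j), (1 / (j * Q) : ℝ) := by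
          refine Finset.sum_le_sum fun n hn => ?_
          have h1 : j * Q ≤ n := by
            rw [← (Finset.mem_filter.1 hn).2]
            exact Nat.div_mul_le_self n Q
          have h2 : (j : ℝ) * Q ≤ n := by exact_mod_cast h1
          exact one_div_le_one_div_of_le (by positivity) h2
      _ ≤ B * (1 / (j * Q)) := by
          rw [Finset.sum_const, nsmul_eq_mul]
          gcongr
      _ = B / Q * (1 / j) := by field_simp
  refine (Finset.sum_le_sum hfib).trans ?_
  rw [← Finset.mul_sum]
  gcongr
  have hc : J.card ≤ 21 * Q ^ 2 :=
    (Finset.card_filter_le _ _).trans (card_blocks_le hQ hE hα hL x 0)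
  have := sum_inv_le_two_add_log (J := J) (fun j hj => (Finset.mem_filter.1 hj).2)
    (by positivity) hc
  exact_mod_cast this

end Blocks

/-! ### Continued fractions with prescribed digits -/

/-- The complete quotients `x n = [d n, d (n + 1), …]` in `(0, 1)` of a continued fraction. -/
def IsQuotientSeq (d : ℕ → ℕ) (x : ℕ → ℝ) : Prop :=
  ∀ n, 0 < x n ∧ x n < 1 ∧ x n * (d n + x (n + 1)) = 1

theorem exists_truncated_quotients (m : ℕ) (d : ℕ → ℕ) (hd : ∀ n, 1 ≤ d n) :
    ∃ x : ℕ → ℝ, (∀ n, x n ∈ Icc (0 : ℝ) 1) ∧ ∀ n < m, x n * (d n + x (n + 1)) = 1 := by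
  induction m generalizing d with
  | zero => exact ⟨fun _ => 0, fun n => by simp, by simp⟩
  | succ m ih =>
    obtain ⟨x, hx, hrec⟩ := ih (fun n => d (n + 1)) fun n => hd _
    have h1 : (1 : ℝ) ≤ d 0 + x 0 := by
      have : (1 : ℝ) ≤ d 0 := by exact_mod_cast hd 0
      linarith [(hx 0).1]
    refine ⟨fun n => Nat.casesOn n (d 0 + x 0)⁻¹ x, ?_, ?_⟩
    · rintro (_ | n)
      · exact ⟨inv_nonneg.2 (zero_le_one.trans h1), inv_le_one_of_one_le₀ h1⟩
      · exact hx n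
    · rintro (_ | n) hn
      · exact inv_mul_cancel₀ (zero_lt_one.trans_le h1).ne'
      · exact hrec n (by omega)

/-- Compactness of `[0, 1] ^ ℕ`: the solutions of the first `m` equations form nested nonempty
closed sets. -/
theorem exists_isQuotientSeq (d : ℕ → ℕ) (hd : ∀ n, 1 ≤ d n) : ∃ x, IsQuotientSeq d x := by
  let C : ℕ → Set (ℕ → ℝ) := fun m =>
    (univ.pi fun _ => Icc (0 : ℝ) 1) ∩ {x | ∀ n < m, x n * (d n + x (n + 1)) = 1}
  have hcl : ∀ m, IsClosed (C m) := by
    intro m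
    refine (isClosed_set_pi fun _ _ => isClosed_Icc).inter ?_
    simp only [ofPred_forall]
    refine isClosed_iInter fun n => isClosed_iInter fun _ => isClosed_eq ?_ continuous_const
    fun_prop
  obtain ⟨x, hx⟩ := IsCompact.nonempty_iInter_of_sequence_nonempty_isCompact_isClosed C
    (fun m => inter_subset_inter_right _ fun x hx n hn => hx n (by omega))
    (fun m => by
      obtain ⟨x, h1, h2⟩ := exists_truncated_quotients m d hd
      exact ⟨x, fun n _ => h1 n, h2⟩)
    ((isCompact_univ_pi fun _ => isCompact_Icc).of_isClosed_subset (hcl 0) inter_subset_left) hcl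
  rw [mem_iInter] at hx
  have hmem : ∀ n, x n ∈ Icc (0 : ℝ) 1 := fun n => (hx 0).1 n (mem_univ n)
  have hrec : ∀ n, x n * (d n + x (n + 1)) = 1 := fun n => (hx (n + 1)).2 n (by omega)
  have hpos : ∀ n, 0 < x n := fun n => (hmem n).1.lt_of_ne fun h => by
    have := hrec n
    rw [← h, zero_mul] at this
    exact zero_ne_one this
  refine ⟨x, fun n => ⟨hpos n, (hmem n).2.lt_of_ne fun h => ?_, hrec n⟩⟩
  have h1 := hrec n
  have h2 : (1 : ℝ) ≤ d n := by exact_mod_cast hd n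
  rw [h, one_mul] at h1
  linarith [hpos (n + 1)]

theorem IsQuotientSeq.tail {d : ℕ → ℕ} {x : ℕ → ℝ} (h : IsQuotientSeq d x) :
    IsQuotientSeq (fun n => d (n + 1)) fun n => x (n + 1) := fun n => h (n + 1)

theorem IsQuotientSeq.inv_eq {d : ℕ → ℕ} {x : ℕ → ℝ} (h : IsQuotientSeq d x) (n : ℕ) :
    (x n)⁻¹ = d n + x (n + 1) := inv_eq_of_mul_eq_one_right (h n).2.2

theorem IsQuotientSeq.floor_inv {d : ℕ → ℕ} {x : ℕ → ℝ} (h : IsQuotientSeq d x) (n : ℕ) :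
    ⌊(x n)⁻¹⌋ = d n := by
  rw [h.inv_eq, Int.floor_natCast_add, Int.floor_eq_zero_iff.2 ⟨(h _).1.le, (h _).2.1⟩, add_zero]

theorem IsQuotientSeq.fract_inv {d : ℕ → ℕ} {x : ℕ → ℝ} (h : IsQuotientSeq d x) (n : ℕ) :
    Int.fract (x n)⁻¹ = x (n + 1) := by
  rw [h.inv_eq, Int.fract_natCast_add, Int.fract_eq_self.2 ⟨(h _).1.le, (h _).2.1⟩]

theorem IsQuotientSeq.of_s_get? {d : ℕ → ℕ} {x : ℕ → ℝ} (h : IsQuotientSeq d x) {v : ℝ}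
    (hv : Int.fract v = x 0) (n : ℕ) :
    (GenContFract.of v).s.get? n = some ⟨1, (d n : ℝ)⟩ := by
  induction n generalizing d x v with
  | zero =>
    have := GenContFract.of_s_head (v := v) (by rw [hv]; exact (h 0).1.ne')
    rw [hv, h.floor_inv] at this
    exact_mod_cast this
  | succ n ih =>
    rw [GenContFract.of_s_succ, hv]
    exact ih h.tail (h.fract_inv 0)

theorem IsQuotientSeq.partDens_get? {d : ℕ → ℕ} {x : ℕ → ℝ} (h : IsQuotientSeq d x) (n : ℕ) :
    (GenContFract.of (x 0)).partDens.get? n = some (d n : ℝ) :=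
  GenContFract.partDen_eq_s_b
    (h.of_s_get? (Int.fract_eq_self.2 ⟨(h 0).1.le, (h 0).2.1⟩) n)

theorem IsQuotientSeq.irrational {d : ℕ → ℕ} {x : ℕ → ℝ} (h : IsQuotientSeq d x) :
    Irrational (x 0) := by
  rintro ⟨q, hq⟩
  obtain ⟨n, hn⟩ := (GenContFract.terminates_iff_rat (x 0)).2 ⟨q, hq.symm⟩
  change (GenContFract.of (x 0)).s.get? n = none at hn
  rw [h.of_s_get? (Int.fract_eq_self.2 ⟨(h 0).1.le, (h 0).2.1⟩)] at hn
  exact absurd hn (by simp)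

/-! ### Odd denominators and their approximations -/

/-- The digits `2 a₁, 1, 2 a₂, 1, …`. -/
def digits (a : ℕ → ℕ) (n : ℕ) : ℕ := if Even n then 2 * a (n / 2) else 1

theorem digits_two_mul (a : ℕ → ℕ) (n : ℕ) : digits a (2 * n) = 2 * a n := by
  simp [digits]

theorem digits_two_mul_add_one (a : ℕ → ℕ) (n : ℕ) : digits a (2 * n + 1) = 1 := by
  simp [digits]

theorem one_le_digits {a : ℕ → ℕ} (ha : ∀ n, 1 ≤ a n) (n : ℕ) : 1 ≤ digits a n := by
  have := ha (n / 2)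
  unfold digits
  split_ifs <;> omega

/-- One step of the recursion for the pairs `(q_{2k-1}, q_{2k})` of denominators of convergents of
`[2 a₁, 1, 2 a₂, 1, …]`. -/
def denomStep (a : ℕ) (z : ℕ × ℕ) : ℕ × ℕ :=
  (2 * a * z.2 + z.1, 2 * a * z.2 + z.1 + z.2)

/-- The pairs `(q_{2k-1}, q_{2k})` of denominators of convergents of `[2 a₁, 1, 2 a₂, 1, …]`. -/
def denoms (a : ℕ → ℕ) : ℕ → ℕ × ℕ
  | 0 => (0, 1)
  | k + 1 => denomStep (a k) (denoms a k)

/-- The denominators `q_{2k}`. -/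
def evenDenom (a : ℕ → ℕ) (k : ℕ) : ℕ := (denoms a k).2

section Denominators

variable {a : ℕ → ℕ}

theorem even_odd_denoms (a : ℕ → ℕ) (k : ℕ) :
    Even (denoms a k).1 ∧ Odd (denoms a k).2 ∧ (denoms a k).1 ≤ (denoms a k).2 := by
  induction k with
  | zero => simp [denoms]
  | succ k ih =>
    obtain ⟨h1, h2, h3⟩ := ih
    have h4 : Even (2 * a k * (denoms a k).2 + (denoms a k).1) :=
      (((even_two_mul _).mul_right _)).add h1
    exact ⟨h4, h4.add_odd h2, Nat.le_add_right _ _⟩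

theorem odd_evenDenom (a : ℕ → ℕ) (k : ℕ) : Odd (evenDenom a k) := (even_odd_denoms a k).2.1

theorem evenDenom_succ_le (a : ℕ → ℕ) (k : ℕ) :
    evenDenom a (k + 1) ≤ (2 * a k + 2) * evenDenom a k := by
  have := (even_odd_denoms a k).2.2
  simp only [evenDenom, denoms, denomStep]
  nlinarith

theorem le_evenDenom_succ (a : ℕ → ℕ) (k : ℕ) :
    (2 * a k + 1) * evenDenom a k ≤ evenDenom a (k + 1) := by
  simp only [evenDenom, denoms, denomStep]
  nlinarith

theorem exists_approx (ha : ∀ n, 1 ≤ a n) {x : ℕ → ℝ} (h : IsQuotientSeq (digits a) x) (k : ℕ) :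
    ∃ E : ℝ, 0 ≤ E ∧ evenDenom a k • (x 0 : UnitAddCircle) = (E : UnitAddCircle) ∧
      ((2 * a k + 2 : ℕ) : ℝ) * E ≤ 2 := by
  -- `F` and `F * x (2 * k)` are the errors of the two consecutive convergents, of opposite sign;
  -- the identity with value `1` is the determinant relation and yields `F ≤ 1`.
  have key : ∃ F : ℝ, 0 < F ∧ (denoms a k).2 * F + (denoms a k).1 * (F * x (2 * k)) = 1 ∧
      (denoms a k).2 • (x 0 : UnitAddCircle) = ((F * x (2 * k) : ℝ) : UnitAddCircle) ∧
      (denoms a k).1 • (x 0 : UnitAddCircle) = ((-F : ℝ) : UnitAddCircle) := by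
    induction k with
    | zero =>
      refine ⟨1, one_pos, by simp [denoms], by simp [denoms], ?_⟩
      rw [AddCircle.coe_neg, AddCircle.coe_period]
      simp [denoms]
    | succ k ih =>
      obtain ⟨F, hF, h1, h2, h3⟩ := ih
      have e1 := (h (2 * k)).2.2
      have e2 := (h (2 * k + 1)).2.2
      rw [digits_two_mul] at e1
      rw [digits_two_mul_add_one] at e2
      push_cast at e1 e2
      have e1' : F * x (2 * k) * x (2 * k + 1) = F - 2 * a k * (F * x (2 * k)) := by
        linear_combination F * e1
      have e2' : F * x (2 * k) * x (2 * k + 1) * x (2 * k + 2) =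
          F * x (2 * k) - F * x (2 * k) * x (2 * k + 1) := by
        linear_combination F * x (2 * k) * e2
      have h4 : (2 * a k * (denoms a k).2 + (denoms a k).1) • (x 0 : UnitAddCircle) =
          ((-(F * x (2 * k) * x (2 * k + 1)) : ℝ) : UnitAddCircle) := by
        rw [add_nsmul, mul_nsmul', h2, h3, ← AddCircle.coe_nsmul, ← AddCircle.coe_add, e1']
        congr 1
        rw [nsmul_eq_mul]
        push_cast
        ring
      refine ⟨F * x (2 * k) * x (2 * k + 1),
        mul_pos (mul_pos hF (h _).1) (h _).1, ?_, ?_, h4⟩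
      · simp only [denoms, denomStep, mul_add, mul_one]
        push_cast
        rw [e2', e1']
        linear_combination h1
      · change (2 * a k * (denoms a k).2 + (denoms a k).1 + (denoms a k).2) •
          (x 0 : UnitAddCircle) = _
        rw [add_nsmul, h4, h2, ← AddCircle.coe_add, mul_add, mul_one, e2']
        congr 1
        ring
  obtain ⟨F, hF, h1, h2, -⟩ := key
  have hE : 0 < F * x (2 * k) := mul_pos hF (h _).1
  refine ⟨F * x (2 * k), hE.le, h2, ?_⟩
  have e1 := (h (2 * k)).2.2
  rw [digits_two_mul] at e1
  push_cast at e1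
  have hQ : (1 : ℝ) ≤ (denoms a k).2 := by exact_mod_cast (odd_evenDenom a k).pos
  have hF1 : F ≤ 1 := by
    have : (0 : ℝ) ≤ (denoms a k).1 * (F * x (2 * k)) := by positivity
    nlinarith
  have h5 : 2 * a k * (F * x (2 * k)) ≤ 1 := by
    have h6 : 0 < F * x (2 * k) * x (2 * k + 1) := mul_pos hE (h _).1
    have : 2 * a k * (F * x (2 * k)) + F * x (2 * k) * x (2 * k + 1) = F := by
      linear_combination F * e1
    linarith
  have ha1 : (1 : ℝ) ≤ a k := by exact_mod_cast ha k
  push_cast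
  nlinarith

end Denominators

/-! ### Choice of the digits and summability -/

open Filter Topology in
-- The bounds hold for all larger `A` because they are applied at `heightSum a n` and at `evenDenom
-- a (n + 1)`, not at `a n` itself.
theorem exists_growth_bound (M : ℕ) (hM : 1 ≤ M) (c : ℕ → ℝ) (hc : ∀ n, 0 < c n) (n Q : ℕ) :
    ∃ N : ℕ, 1 ≤ N ∧ ∀ A : ℕ, N ≤ A →
      Real.log (2 * (M : ℝ) * A) / A < c n ∧
      21 * (Q : ℝ) ^ 3 / A * (2 + Real.log (21 * (A : ℝ) ^ 2)) ≤ (1 / 2) ^ n := by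
  have hlog : Tendsto (fun A : ℕ => Real.log A / A) atTop (𝓝 0) :=
    (Real.isLittleO_log_id_atTop.tendsto_div_nhds_zero).comp tendsto_natCast_atTop_atTop
  have hinv : Tendsto (fun A : ℕ => (1 : ℝ) / A) atTop (𝓝 0) :=
    tendsto_one_div_atTop_nhds_zero_nat
  have h1 : Tendsto (fun A : ℕ => Real.log (2 * M) * (1 / A : ℝ) + Real.log A / A) atTop (𝓝 0) := by
    simpa using (hinv.const_mul (Real.log (2 * M))).add hlog
  have h2 : Tendsto (fun A : ℕ => 21 * (Q : ℝ) ^ 3 *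
      ((2 + Real.log 21) * (1 / A : ℝ) + 2 * (Real.log A / A))) atTop (𝓝 0) := by
    simpa using ((hinv.const_mul (2 + Real.log 21)).add (hlog.const_mul 2)).const_mul
      (21 * (Q : ℝ) ^ 3)
  obtain ⟨N, hN⟩ := eventually_atTop.1
    ((h1.eventually_lt_const (hc n)).and
      (h2.eventually_lt_const (show (0 : ℝ) < (1 / 2) ^ n by positivity)))
  refine ⟨N + 1, by omega, fun A hA => ?_⟩
  obtain ⟨h3, h4⟩ := hN A (by omega)
  have hA0 : (0 : ℝ) < A := by exact_mod_cast (by omega : 0 < A)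
  have hM0 : (0 : ℝ) < M := by exact_mod_cast hM
  constructor
  · rw [Real.log_mul (by positivity) hA0.ne']
    convert! h3 using 1
    ring
  · rw [Real.log_mul (by norm_num) (by positivity), Real.log_pow]
    refine le_trans (le_of_eq ?_) h4.le
    push_cast
    ring

section Choice

variable {a : ℕ → ℕ}

theorem lt_evenDenom (ha : ∀ n, 1 ≤ a n) (k : ℕ) : k < evenDenom a k := by
  induction k with
  | zero => simp [evenDenom, denoms]
  | succ k ih =>
    have := le_evenDenom_succ a k
    have := ha k
    nlinarith

theorem summable_balancedTimes (ha : ∀ n, 1 ≤ a n)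
    (hgrowth : ∀ n, ∀ A : ℕ, a n ≤ A →
      21 * (evenDenom a n : ℝ) ^ 3 / A * (2 + Real.log (21 * (A : ℝ) ^ 2)) ≤ (1 / 2) ^ n)
    {x : ℕ → ℝ} (hx : IsQuotientSeq (digits a) x) (y : UnitAddCircle) :
    Summable fun n : balancedTimes (x 0) y => (1 : ℝ) / ((n : ℕ) : ℝ) := by
  classical
  set α := x 0
  have hstage : ∀ k, ∑ n ∈ (Finset.Ico (evenDenom a (k + 1)) (evenDenom a (k + 2))).filter
      (fun n => height α n y = 0), (1 / n : ℝ) ≤ (1 / 2) ^ k := by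
    intro k
    obtain ⟨E, hE, hαE, hL⟩ := exists_approx ha hx k
    obtain ⟨E', hE', hαE', hL'⟩ := exists_approx ha hx (k + 1)
    -- Scale `k` bounds the visits within one block of scale `k + 1`.
    have hB : ∀ (z : UnitAddCircle) (h : ℤ), ((Finset.range (evenDenom a (k + 1))).filter
        fun n => height α n z = h).card ≤ 21 * evenDenom a k ^ 3 := by
      intro z h
      refine le_trans (Finset.card_le_card (Finset.filter_subset_filter _ ?_))
        (card_level_le (odd_evenDenom a k) hE hαE hL z h)
      exact Finset.range_subset_range.2 (evenDenom_succ_le a k)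
    have hA : a k ≤ evenDenom a (k + 1) := by
      have := le_evenDenom_succ a k
      have := (odd_evenDenom a k).pos
      nlinarith
    have h1 := sum_inv_balanced_le (odd_evenDenom a (k + 1)) hE' hαE' hL' hB y
    have h2 := hgrowth k _ hA
    push_cast at h1
    refine le_trans ?_ (h1.trans h2)
    refine Finset.sum_le_sum_of_subset_of_nonneg ?_ fun _ _ _ => by positivity
    exact Finset.filter_subset_filter _ (Finset.Ico_subset_Ico_right (evenDenom_succ_le a (k + 1)))
  set g : ℕ → ℝ := fun n => if height α n y = 0 then (1 / n : ℝ) else 0 with hg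
  have hg0 : ∀ n, 0 ≤ g n := fun n => by
    simp only [hg]
    split_ifs <;> positivity
  have hmono : ∀ k, evenDenom a k ≤ evenDenom a (k + 1) := fun k => by
    have := le_evenDenom_succ a k
    nlinarith
  have hpartial : ∀ k, ∑ n ∈ Finset.range (evenDenom a (k + 1)), g n ≤
      ∑ n ∈ Finset.range (evenDenom a 1), g n + ∑ i ∈ Finset.range k, (1 / 2 : ℝ) ^ i := by
    intro k
    induction k with
    | zero => simp
    | succ k ih =>
      have := hstage k
      rw [Finset.sum_filter] at this
      rw [← Finset.sum_range_add_sum_Ico _ (hmono (k + 1)), Finset.sum_range_succ]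
      linarith
  have hsum : Summable g := by
    refine summable_of_sum_range_le
      (c := ∑ n ∈ Finset.range (evenDenom a 1), g n + 2) hg0 fun n => ?_
    calc ∑ i ∈ Finset.range n, g i ≤ ∑ i ∈ Finset.range (evenDenom a (n + 1)), g i :=
          Finset.sum_le_sum_of_subset_of_nonneg
            (Finset.range_subset_range.2
              ((lt_evenDenom ha n).le.trans (hmono n))) fun i _ _ => hg0 i
      _ ≤ _ := hpartial n
      _ ≤ _ := by
          gcongr
          exact sum_geometric_two_le n
  refine (hsum.subtype (balancedTimes α y)).congr fun n => ?_
  simp only [Function.comp_apply, hg, if_pos (mem_balancedTimes.1 n.2).2]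

/-- A sequence may be chosen digit by digit, each digit depending on the denominators so far. -/
theorem exists_digit_choice (pick : ℕ → ℕ → ℕ) : ∃ a : ℕ → ℕ, ∀ n, a n = pick n (evenDenom a n) := by
  let st : ℕ → ℕ × ℕ := fun n =>
    Nat.rec (0, 1) (fun k z => denomStep (pick k z.2) z) n
  refine ⟨fun n => pick n (st n).2, fun n => ?_⟩
  have : ∀ n, denoms (fun n => pick n (st n).2) n = st n := by
    intro n
    induction n with
    | zero => rfl
    | succ n ih => rw [denoms, ih]
  simp only [evenDenom, this]

theorem le_heightSum (a : ℕ → ℕ) (n : ℕ) : a n ≤ heightSum a n :=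
  Finset.single_le_sum (f := a) (fun _ _ => Nat.zero_le _) (Finset.self_mem_range_succ n)

end Choice

end BalancedTimes

/-- For every bound `M` and every summable sequence `c` of positive reals, there are uncountably
many irrational `α = [2 a₁, b₁, 2 a₂, b₂, …]` in `(0, 1)`, with `b_i ≤ M` and with `a_i` growing
so fast that `log (2 M A_n) / A_n < c_n`, such that the sum of `1 / n` over the balanced times
`V_{α,x}` is finite for every point `x` of the circle. -/
theorem theorem2 (M : ℕ) (hM : 1 ≤ M) (c : ℕ → ℝ) (hc_pos : ∀ n, 0 < c n) (hc : Summable c) :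
    ¬ Set.Countable {α : ℝ |
        (0 < α ∧ α < 1 ∧ Irrational α) ∧
        (∃ a b : ℕ → ℕ,
          BalancedTimes.HasAlternatingExpansion α a b ∧
          (∀ n, 1 ≤ a n) ∧ (∀ n, 1 ≤ b n ∧ b n ≤ M) ∧
          (∀ n, Real.log (2 * (M : ℝ) * (BalancedTimes.heightSum a n : ℝ)) /
            (BalancedTimes.heightSum a n : ℝ) < c n)) ∧
        (∀ x : UnitAddCircle,
          Summable (fun n : BalancedTimes.balancedTimes α x => (1 : ℝ) / ((n : ℕ) : ℝ)))} := by
  classical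
  intro hcount
  obtain ⟨e, he⟩ := Set.countable_iff_exists_subset_range.1 hcount
  choose N hN1 hN using BalancedTimes.exists_growth_bound M hM c hc_pos
  -- Diagonal choice: `a n` is `N n Q` or `N n Q + 1`, whichever makes digit `2 * n` differ from
  -- that of `e n`.
  obtain ⟨a, ha⟩ := BalancedTimes.exists_digit_choice fun n Q =>
    if (GenContFract.of (e n)).partDens.get? (2 * n) = some (2 * (N n Q : ℝ)) then N n Q + 1
    else N n Q
  have hNa : ∀ n, N n (BalancedTimes.evenDenom a n) ≤ a n := by
    intro n
    have := ha n
    split_ifs at this <;> omega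
  have ha1 : ∀ n, 1 ≤ a n := fun n => (hN1 _ _).trans (hNa n)
  have havoid : ∀ n, (GenContFract.of (e n)).partDens.get? (2 * n) ≠ some (2 * (a n : ℝ)) := by
    intro n heq
    have := ha n
    split_ifs at this with h
    · rw [h, this] at heq
      simp at heq
    · rw [this] at heq
      exact h heq
  obtain ⟨x, hx⟩ := BalancedTimes.exists_isQuotientSeq (BalancedTimes.digits a)
    (BalancedTimes.one_le_digits ha1)
  have hexp : BalancedTimes.HasAlternatingExpansion (x 0) a fun _ => 1 := by
    refine fun n => ⟨?_, ?_⟩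
    · rw [hx.partDens_get?, BalancedTimes.digits_two_mul]
      push_cast
      rfl
    · rw [hx.partDens_get?, BalancedTimes.digits_two_mul_add_one]
  obtain ⟨n, hn⟩ := he (show x 0 ∈ _ from
    ⟨⟨(hx 0).1, (hx 0).2.1, hx.irrational⟩,
      ⟨a, fun _ => 1, hexp, ha1, fun _ => ⟨le_rfl, hM⟩, fun n =>
        (hN n (BalancedTimes.evenDenom a n) _
          ((hNa n).trans (BalancedTimes.le_heightSum a n))).1⟩,
      fun y => BalancedTimes.summable_balancedTimes ha1
        (fun n A hA => (hN n (BalancedTimes.evenDenom a n) A ((hNa n).trans hA)).2) hx y⟩)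
  exact havoid n (hn ▸ (hexp n).1)
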